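/- Let $K\in\{2,3\}$. Let $\mathbf h_{i,j}\in\mathbb C^{K}$ ($1\le i,j\le K$) be channel vectors (from source $j$ to receiver $i$), and let $\gamma_i>0$, $\lambda_i\ge 0$, $\sigma\ge 0$, $\sigma_C>0$ be real. The original problem is $$\min_{\{\mathbf v_i\in\mathbb C^K,\ \rho_i\}}\ \sum_{i=1}^K\|\mathbf v_i\|^2\quad\text{s.t.}\quad \Gamma_i=\frac{|\mathbf h_{i,i}^T\mathbf v_i|^2}{\sum_{j\ne i}|\mathbf h_{i,j}^T\mathbf v_j|^2+\sigma^2+\sigma_C^2/\rho_i}\ge\gamma_i,\quad (1-\rho_i)\Big(\sum_{j=1}^K|\mathbf h_{i,j}^T\mathbf v_j|^2+\sigma^2\Big)\ge\lambda_i,\quad 0\le\rho_i\le1\quad\forall i, \tag{P}$$ with $\Gamma_i=0$ when $\rho_i=0$. Its rank-relaxed semidefinite program, over $\mathbf W_i\in\mathbb C^{K\times K}$ and $\rho_i\in\mathbb R$, is $$\min_{\{\mathbf W_i,\rho_i\}}\ \sum_{i=1}^K\operatorname{trace}(\mathbf W_i)\quad\text{s.t.}\quad \begin{bmatrix}\frac1{\gamma_i}g_{i,i}-\sum_{j\ne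 i}g_{i,j}-\sigma^2&\sigma_C\\ \sigma_C&\rho_i\end{bmatrix}\succeq0,\quad \begin{bmatrix}\sum_{j=1}^K g_{i,j}+\sigma^2&\sqrt{\lambda_i}\\ \sqrt{\lambda_i}&1-\rho_i\end{bmatrix}\succeq0,\quad \mathbf W_i\succeq0,\quad 0\le\rho_i\le1\quad\forall i, \tag{SDP}$$ where $g_{i,j}=\operatorname{trace}(\mathbf h_{i,j}^*\mathbf h_{i,j}^T\mathbf W_j)$. (a) For all channel vectors and parameters as above: if (SDP) is feasible, then it has an optimal solution $(\{\mathbf v_i\mathbf v_i^H\},\{\rho_i\})$ in which every $\mathbf v_i\mathbf v_i^H$ has rank $1$ and such that $(\{\mathbf v_i\},\{\rho_i\})$ is an optimal solution of (P). Moreover, if $(\{\mathbf W_i\},\{\rho_i\})$ is any optimal solution of (SDP) with every $\mathbf W_i$ of rank $1$, then $\mathbf W_i=\mathbf v_i\mathbf v_i^H$ for some vectors $\mathbf v_i$, and for every such choice $(\{\mathbf v_i\},\{\rho_i\})$ is an optimal solution of (P). (b) For every optimal solution $(\{\mathbf W_i\},\{\rho_i\})$ of (SDP) and every index $i$ there is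 $\mathbf v\in\mathbb C^K$ such that $\mathbf v\mathbf v^H$ has rank $1$, $\operatorname{trace}(\mathbf W_i)=\|\mathbf v\|^2$ and $\operatorname{trace}(\mathbf h_{j,i}^*\mathbf h_{j,i}^T\mathbf W_i)=|\mathbf h_{j,i}^T\mathbf v|^2$ for all $j$; replacing $\mathbf W_i$ by $\mathbf v\mathbf v^H$ therefore changes neither the objective nor the constraints, and gives again an optimal solution of (SDP). (c) Let the channel be random (Rayleigh fading): all coefficients of the vectors $\mathbf h_{i,j}$ are independent, those of $\mathbf h_{i,j}$ with law $\mathcal{CN}(0,s_{i,j})$, $s_{i,j}>0$. Then with probability one the following holds simultaneously for all parameters $\gamma_i>0$, $\lambda_i\ge0$, $\sigma\ge0$, $\sigma_C>0$ and all optimal solutions of (SDP): if $K=2$, every $\mathbf W_i$ has rank $1$; if $K=3$, at most one $\mathbf W_i$ has rank $2$ and all others have rank $1$. -/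

import Mathlib

open scoped NNReal Matrix

noncomputable section

namespace MisoSWIPT

open Matrix MeasureTheory ProbabilityTheory
open scoped ComplexOrder

/-- Channel vectors: `h i j` is the vector of the link from source `j` to receiver `i`;
every one of the `K` sources has `K` antennas. -/
abbrev Channel (K : ℕ) : Type := Fin K → Fin K → Fin K → ℂ

/-- Data of the design problem besides the channels: SINR thresholds `γ`, energy-harvesting
thresholds `lam`, antenna-noise and circuit-noise standard deviations `σ` and `σC`. -/
structure Params (K : ℕ) where
  γ : Fin K → ℝ
  lam : Fin K → ℝ
  σ : ℝ
  σC : ℝ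

/-- Sign conventions on the data. -/
structure Params.Admissible {K : ℕ} (p : Params K) : Prop where
  γ_pos : ∀ i, 0 < p.γ i
  lam_nonneg : ∀ i, 0 ≤ p.lam i
  σ_nonneg : 0 ≤ p.σ
  σC_pos : 0 < p.σC

/-! ### The original beamforming problem -/

/-- A point `(v, ρ)`: beamforming vectors (with the Euclidean norm) and splitting ratios. -/
abbrev BeamPoint (K : ℕ) : Type := (Fin K → EuclideanSpace ℂ (Fin K)) × (Fin K → ℝ)

/-- `|h_{i,j}ᵀ v|²`. -/
def beamGain {K : ℕ} (h : Channel K) (i j : Fin K) (v : EuclideanSpace ℂ (Fin K)) : ℝ :=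
  ‖h i j ⬝ᵥ v.ofLp‖ ^ 2

/-- The SINR of receiver `i`. It is the quotient of `|h_{i,i}ᵀ v_i|²` by
`∑_{j ≠ i} |h_{i,j}ᵀ v_j|² + σ² + σC² / ρ_i`, numerator and denominator multiplied by `ρ_i`,
so that it is also meaningful (and equal to `0`) at `ρ_i = 0`. -/
def sinr {K : ℕ} (p : Params K) (h : Channel K) (x : BeamPoint K) (i : Fin K) : ℝ :=
  x.2 i * beamGain h i i (x.1 i) /
    (x.2 i * (∑ j ∈ Finset.univ.erase i, beamGain h i j (x.1 j) + p.σ ^ 2) + p.σC ^ 2)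

def beamFeasible {K : ℕ} (p : Params K) (h : Channel K) : Set (BeamPoint K) :=
  {x | ∀ i, p.γ i ≤ sinr p h x i ∧
    p.lam i ≤ (1 - x.2 i) * (∑ j, beamGain h i j (x.1 j) + p.σ ^ 2) ∧
    0 ≤ x.2 i ∧ x.2 i ≤ 1}

def beamObjective {K : ℕ} (x : BeamPoint K) : ℝ := ∑ i, ‖x.1 i‖ ^ 2

/-- Globally optimal solutions of the original problem. -/
def BeamOptimal {K : ℕ} (p : Params K) (h : Channel K) (x : BeamPoint K) : Prop :=
  x ∈ beamFeasible p h ∧ IsMinOn beamObjective (beamFeasible p h) x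

/-! ### The rank-relaxed semidefinite program -/

/-- A point `(W, ρ)`. -/
abbrev SdpPoint (K : ℕ) : Type := (Fin K → Matrix (Fin K) (Fin K) ℂ) × (Fin K → ℝ)

/-- `trace (h_{i,j}^* h_{i,j}ᵀ W)`; this trace is real for Hermitian `W`. -/
def matGain {K : ℕ} (h : Channel K) (i j : Fin K) (W : Matrix (Fin K) (Fin K) ℂ) : ℝ :=
  (trace (vecMulVec (star (h i j)) (h i j) * W)).re

def matA {K : ℕ} (p : Params K) (h : Channel K) (x : SdpPoint K) (i : Fin K) :
    Matrix (Fin 2) (Fin 2) ℝ :=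
  !![1 / p.γ i * matGain h i i (x.1 i)
        - ∑ j ∈ Finset.univ.erase i, matGain h i j (x.1 j) - p.σ ^ 2, p.σC;
     p.σC, x.2 i]

def matB {K : ℕ} (p : Params K) (h : Channel K) (x : SdpPoint K) (i : Fin K) :
    Matrix (Fin 2) (Fin 2) ℝ :=
  !![∑ j, matGain h i j (x.1 j) + p.σ ^ 2, √(p.lam i);
     √(p.lam i), 1 - x.2 i]

def sdpFeasible {K : ℕ} (p : Params K) (h : Channel K) : Set (SdpPoint K) :=
  {x | ∀ i, (matA p h x i).PosSemidef ∧ (matB p h x i).PosSemidef ∧ (x.1 i).PosSemidef ∧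
    0 ≤ x.2 i ∧ x.2 i ≤ 1}

/-- `∑ trace W_i`, real for Hermitian `W_i`. -/
def sdpObjective {K : ℕ} (x : SdpPoint K) : ℝ := ∑ i, (trace (x.1 i)).re

/-- Optimal solutions of the semidefinite program. -/
def SdpOptimal {K : ℕ} (p : Params K) (h : Channel K) (x : SdpPoint K) : Prop :=
  x ∈ sdpFeasible p h ∧ IsMinOn sdpObjective (sdpFeasible p h) x

/-- The matrix `v vᴴ`. -/
def outer {K : ℕ} (v : EuclideanSpace ℂ (Fin K)) : Matrix (Fin K) (Fin K) ℂ :=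
  vecMulVec v.ofLp (star v.ofLp)

/-! ### Rayleigh fading -/

/-- The circularly symmetric complex Gaussian law with mean `0` and variance `s`:
independent real and imaginary parts, each a centred Gaussian of variance `s / 2`. -/
def complexGaussian (s : ℝ≥0) : Measure ℂ :=
  ((gaussianReal 0 (s / 2)).prod (gaussianReal 0 (s / 2))).map
    Complex.measurableEquivRealProd.symm

/-- The law of the channel: all coefficients are independent, and those of `h i j` are
circularly symmetric complex Gaussian with variance `s i j`. -/
def rayleighLaw (K : ℕ) (s : Fin K → Fin K → ℝ≥0) : Measure (Channel K) :=
  Measure.pi fun i => Measure.pi fun j => Measure.pi fun _ => complexGaussian (s i j)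

end MisoSWIPT

end

open scoped NNReal Matrix

noncomputable section

namespace MisoSWIPT

open Matrix MeasureTheory ProbabilityTheory
open scoped ComplexOrder ContDiff

/-! ### Zero sets of real-analytic functions are null -/

/-! On rank-one matrices the Schur complement turns the 2×2 semidefinite constraints into those of
the original problem (`outer_mem_sdpFeasible_iff`). So a rank-one optimum of the relaxation is an
optimum of the original problem, and the matter is the rank of the `W i`. Each `W i` enters only
through its `K` gains and its trace, so at an optimum it has least trace among the positive
semidefinite matrices with its gains (`SdpOptimal.trace_le`). Among those with the same trace take
an extreme point. If it had two positive eigenvalues, Hermitian perturbations of that eigenplane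
would form a real space of dimension 4. As `K < 4`, a nonzero one preserves all gains
(`exists_perturbation`); minimality in both directions makes it preserve the trace too,
contradicting extremality. The trace thus costs no fourth linear condition, which is what admits `K
= 3`. Optima exist by compactness, and the factors are nonzero because `σC > 0`. For generic
channels more is proved than asked: all ranks are one. Write `W = A * Aᴴ`, let `H` have the channel
vectors leaving the source as rows, and let `R j` be the rows of `H * A`. The gains are `‖R j‖ ^ 2`,
and the trace is a quadratic form in the `R j` with Gram matrix `N = (H * Hᴴ)⁻¹`. Minimality over
the product of spheres gives `∑ l, N j l • R l = ν j • R j` with real `ν j` whenever `R j ≠ 0`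
(`gram_smul_eq_of_isMin`). This forces the `R j` to be collinear once `N 0 1 ≠ 0` (`K = 2`) or `N 0
1 * N 1 2 * N 2 0` is not real (`K = 3`). Up to positive factors these are real-analytic conditions
on the channel, satisfied somewhere, hence almost surely. -/

/-- Every real-analytic function that does not vanish identically is nonzero almost everywhere. -/
def NullAnalyticZeros {E : Type*} [NormedAddCommGroup E] [NormedSpace ℝ E] [MeasurableSpace E]
    (μ : Measure E) : Prop :=
  ∀ f : E → ℝ, ContDiff ℝ ω f → (∃ x, f x ≠ 0) → ∀ᵐ x ∂μ, f x ≠ 0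

lemma nullAnalyticZeros_volume : NullAnalyticZeros (volume : Measure ℝ) := by
  rintro f hf ⟨x, hx⟩
  have h := (hf.analyticOnNhd (s := Set.univ)).preimage_zero_mem_codiscrete hx
  have h' := ae_restrict_le_codiscreteWithin (μ := (volume : Measure ℝ)) MeasurableSet.univ h
  rw [Measure.restrict_univ] at h'
  filter_upwards [h'] with y hy
  simpa using hy

lemma nullAnalyticZeros_gaussianReal {v : ℝ≥0} (hv : v ≠ 0) :
    NullAnalyticZeros (gaussianReal 0 v) := fun f hf hx =>
  (gaussianReal_absolutelyContinuous 0 hv).ae_le (nullAnalyticZeros_volume f hf hx)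

section

variable {E F : Type*} [NormedAddCommGroup E] [NormedSpace ℝ E] [MeasurableSpace E]
  [NormedAddCommGroup F] [NormedSpace ℝ F] [MeasurableSpace F]

/-- Fubini: a slice through a point where `f` is nonzero is nonzero for almost every `x`, and for
each such `x` the other slice is nonzero almost everywhere. -/
lemma NullAnalyticZeros.prod [BorelSpace E] [BorelSpace F] [SecondCountableTopology F]
    {μ : Measure E} {ν : Measure F} [SFinite ν] (hμ : NullAnalyticZeros μ)
    (hν : NullAnalyticZeros ν) : NullAnalyticZeros (μ.prod ν) := by
  rintro f hf ⟨⟨x₀, y₀⟩, h₀⟩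
  have hm : MeasurableSet {z : E × F | f z ≠ 0} :=
    (isOpen_ne_fun hf.continuous continuous_const).measurableSet
  rw [Measure.ae_prod_iff_ae_ae hm]
  have h1 : ∀ᵐ x ∂μ, f (x, y₀) ≠ 0 :=
    hμ (fun x => f (x, y₀)) (hf.comp (contDiff_id.prodMk contDiff_const)) ⟨x₀, h₀⟩
  filter_upwards [h1] with x hx
  exact hν (fun y => f (x, y)) (hf.comp (contDiff_const.prodMk contDiff_id)) ⟨y₀, hx⟩

lemma NullAnalyticZeros.of_measurePreserving [BorelSpace F] {μ : Measure E}
    {ν : Measure F} (hμ : NullAnalyticZeros μ) {e : E → F} (he : ContDiff ℝ ω e) (hs : Function.Surjective e)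
    (hp : MeasurePreserving e μ ν) : NullAnalyticZeros ν := by
  rintro f hf ⟨y, hy⟩
  obtain ⟨x, rfl⟩ := hs y
  have h := hμ (f ∘ e) (hf.comp he) ⟨x, hy⟩
  have hm : MeasurableSet {z : F | f z ≠ 0} :=
    (isOpen_ne_fun hf.continuous continuous_const).measurableSet
  rw [← hp.map_eq, ae_map_iff hp.aemeasurable hm]
  exact h

lemma NullAnalyticZeros.pi [BorelSpace E] [SecondCountableTopology E] :
    ∀ {n : ℕ} {μ : Fin n → Measure E} [∀ i, SigmaFinite (μ i)],
    (∀ i, NullAnalyticZeros (μ i)) → NullAnalyticZeros (Measure.pi μ)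
  | 0, μ, _, _ => by
    rintro f - ⟨x, hx⟩
    refine Filter.Eventually.of_forall fun y => ?_
    rwa [Subsingleton.elim y x]
  | n + 1, μ, _, h => by
    have ih : NullAnalyticZeros (Measure.pi fun j : Fin n => μ ((0 : Fin (n + 1)).succAbove j)) :=
      NullAnalyticZeros.pi fun j => h _
    have hp := (measurePreserving_piFinSuccAbove μ 0).symm
    refine ((h 0).prod ih).of_measurePreserving ?_
      (MeasurableEquiv.piFinSuccAbove (fun _ => E) 0).symm.surjective hp
    rw [contDiff_pi]
    intro i
    refine Fin.cases ?_ (fun j => ?_) i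
    · exact contDiff_fst
    · exact (contDiff_apply ℝ E j).comp contDiff_snd

end

instance (s : ℝ≥0) : IsProbabilityMeasure (complexGaussian s) :=
  Measure.isProbabilityMeasure_map (MeasurableEquiv.measurable _).aemeasurable

lemma nullAnalyticZeros_complexGaussian {s : ℝ≥0} (hs : 0 < s) :
    NullAnalyticZeros (complexGaussian s) := by
  have hg := nullAnalyticZeros_gaussianReal (v := s / 2) (by positivity)
  refine (hg.prod hg).of_measurePreserving (e := Complex.measurableEquivRealProd.symm) ?_
    (MeasurableEquiv.surjective _) ⟨MeasurableEquiv.measurable _, rfl⟩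
  exact Complex.equivRealProdCLM.symm.contDiff

lemma nullAnalyticZeros_rayleighLaw {K : ℕ} {s : Fin K → Fin K → ℝ≥0} (hs : ∀ i j, 0 < s i j) :
    NullAnalyticZeros (rayleighLaw K s) :=
  .pi fun i => .pi fun j => .pi fun _ => nullAnalyticZeros_complexGaussian (hs i j)

/-! ### Generic channels -/

/-- The channel vectors leaving source `i`, as the rows of a matrix. -/
def sourceMatrix {K : ℕ} (h : Channel K) (i : Fin K) : Matrix (Fin K) (Fin K) ℂ :=
  Matrix.of fun j k => h j i k

lemma contDiff_sourceMatrix {K : ℕ} (i j k : Fin K) :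
    ContDiff ℝ ω fun h : Channel K => sourceMatrix h i j k :=
  (contDiff_apply ℝ ℂ k).comp ((contDiff_apply ℝ (Fin K → ℂ) i).comp
    (contDiff_apply ℝ (Fin K → Fin K → ℂ) j))

section

variable {E : Type*} [NormedAddCommGroup E] [NormedSpace ℝ E] {n : Type*} [Fintype n]
  [DecidableEq n] {H : E → Matrix n n ℂ}

lemma contDiff_det (hH : ∀ j k, ContDiff ℝ ω fun x => H x j k) :
    ContDiff ℝ ω fun x => (H x).det := by
  simp only [det_apply]
  exact ContDiff.sum fun σ _ => (contDiff_prod fun j _ => hH _ _).const_smul _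

lemma contDiff_adjugate (hH : ∀ j k, ContDiff ℝ ω fun x => H x j k) (j k : n) :
    ContDiff ℝ ω fun x => (H x).adjugate j k := by
  simp only [adjugate_apply]
  refine contDiff_det fun a b => ?_
  simp only [updateRow_apply]
  split_ifs
  · exact contDiff_const
  · exact hH a b

/-- The Gram matrix of the columns of the adjugate: `|det H|²` times the inverse of `H Hᴴ`. -/
def adjugateGram (H : Matrix n n ℂ) : Matrix n n ℂ := H.adjugateᴴ * H.adjugate

lemma contDiff_adjugateGram (hH : ∀ j k, ContDiff ℝ ω fun x => H x j k) (j k : n) :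
    ContDiff ℝ ω fun x => adjugateGram (H x) j k := by
  simp only [adjugateGram, mul_apply, conjTranspose_apply]
  refine ContDiff.sum fun l _ => ContDiff.mul ?_ (contDiff_adjugate hH l k)
  exact Complex.conjCLE.contDiff.comp (contDiff_adjugate hH l j)

end

/-- Imaginary parts reduce complex conditions to real-analytic ones; a single matrix `H` suffices as
witness, since it can be realized as the source matrix of any source. -/
lemma ae_forall_sourceMatrix {K : ℕ} {s : Fin K → Fin K → ℝ≥0} (hs : ∀ i j, 0 < s i j)
    {f : Matrix (Fin K) (Fin K) ℂ → ℂ} (hf : ∀ i, ContDiff ℝ ω fun h => f (sourceMatrix h i))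
    (hne : ∃ H, (f H).im ≠ 0) :
    ∀ᵐ h ∂rayleighLaw K s, ∀ i, (f (sourceMatrix h i)).im ≠ 0 := by
  obtain ⟨H, hH⟩ := hne
  refine ae_all_iff.2 fun i => nullAnalyticZeros_rayleighLaw hs _
    (Complex.imCLM.contDiff.comp (hf i)) ⟨fun j _ k => H j k, hH⟩

lemma ae_det_sourceMatrix_ne_zero {K : ℕ} {s : Fin K → Fin K → ℝ≥0} (hs : ∀ i j, 0 < s i j) :
    ∀ᵐ h ∂rayleighLaw K s, ∀ i, (sourceMatrix h i).det ≠ 0 := by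
  -- The factor `Complex.I` makes the imaginary part equal to the real part of the determinant,
  -- which is 1 at the identity.
  have h1 := ae_forall_sourceMatrix hs (f := fun H => Complex.I * H.det)
    (fun i => contDiff_const.mul (contDiff_det (contDiff_sourceMatrix i))) ⟨1, by simp⟩
  filter_upwards [h1] with h hh i hi
  exact hh i (by simp [hi])

lemma ae_adjugateGram_two {s : Fin 2 → Fin 2 → ℝ≥0} (hs : ∀ i j, 0 < s i j) :
    ∀ᵐ h ∂rayleighLaw 2 s, ∀ i, adjugateGram (sourceMatrix h i) 0 1 ≠ 0 := by
  have h1 := ae_forall_sourceMatrix hs (f := fun H => Complex.I * adjugateGram H 0 1)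
    (fun i => contDiff_const.mul (contDiff_adjugateGram (contDiff_sourceMatrix i) 0 1))
    ⟨!![1, -1; 0, 1], by
      simp [adjugateGram, adjugate_fin_two, mul_apply, Fin.sum_univ_two]⟩
  filter_upwards [h1] with h hh i hi
  exact hh i (by simp [hi])

lemma ae_adjugateGram_three {s : Fin 3 → Fin 3 → ℝ≥0} (hs : ∀ i j, 0 < s i j) :
    ∀ᵐ h ∂rayleighLaw 3 s, ∀ i, (adjugateGram (sourceMatrix h i) 0 1 *
      adjugateGram (sourceMatrix h i) 1 2 * adjugateGram (sourceMatrix h i) 2 0).im ≠ 0 := by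
  have hc := fun i j k => contDiff_adjugateGram (contDiff_sourceMatrix (K := 3) i) j k
  refine ae_forall_sourceMatrix hs (f := fun H => adjugateGram H 0 1 * adjugateGram H 1 2 *
    adjugateGram H 2 0) (fun i => ((hc i 0 1).mul (hc i 1 2)).mul (hc i 2 0))
    -- Chosen as the inverse of a unitriangular matrix with columns (1,0,0), (1,1,0), (1,i,1), whose
    -- Gram entries have cyclic product 1 · (1 + i) · 1.
    ⟨!![1, -1, Complex.I - 1; 0, 1, -Complex.I; 0, 0, 1], ?_⟩
  have hadj : (!![1, -1, Complex.I - 1; 0, 1, -Complex.I; 0, 0, 1] :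
      Matrix (Fin 3) (Fin 3) ℂ).adjugate = !![1, 1, 1; 0, 1, Complex.I; 0, 0, 1] := by
    rw [adjugate_fin_three]
    ext a b
    fin_cases a <;> fin_cases b <;> simp
  simp [adjugateGram, hadj, mul_apply, Fin.sum_univ_three]

/-! ### Positive semidefinite matrices -/

lemma posSemidef_two_iff {a b d : ℝ} :
    (!![a, b; b, d] : Matrix (Fin 2) (Fin 2) ℝ).PosSemidef ↔ 0 ≤ a ∧ 0 ≤ d ∧ b ^ 2 ≤ a * d := by
  constructor
  · intro h
    refine ⟨by simpa using h.diag_nonneg (i := 0), by simpa using h.diag_nonneg (i := 1), ?_⟩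
    have := h.det_nonneg
    rw [det_fin_two_of] at this
    nlinarith
  · rintro ⟨ha, hd, hb⟩
    refine .of_dotProduct_mulVec_nonneg ?_ fun x => ?_
    · ext i j
      fin_cases i <;> fin_cases j <;> simp
    · have key : 0 ≤ a * x 0 ^ 2 + 2 * b * x 0 * x 1 + d * x 1 ^ 2 := by
        rcases ha.eq_or_lt with rfl | ha
        · have : b = 0 := by nlinarith
          subst this
          nlinarith [mul_nonneg hd (sq_nonneg (x 1))]
        · have h1 : 0 ≤ a * (a * x 0 ^ 2 + 2 * b * x 0 * x 1 + d * x 1 ^ 2) := by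
            nlinarith [sq_nonneg (a * x 0 + b * x 1), mul_nonneg (sub_nonneg.2 hb) (sq_nonneg (x 1))]
          exact nonneg_of_mul_nonneg_right h1 ha
      simp [mulVec, dotProduct, Fin.sum_univ_two]
      linarith

section

variable {n : Type*} [Fintype n]

lemma exists_eq_mul_conjTranspose {Z : Matrix n n ℂ} (hZ : Z.PosSemidef) :
    ∃ (m : ℕ) (A : Matrix n (Fin m) ℂ), Z = A * Aᴴ := by
  obtain ⟨m, v, rfl⟩ := posSemidef_iff_eq_sum_vecMulVec.1 hZ
  refine ⟨m, .of fun k l => v l k, ?_⟩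
  ext a b
  simp [Matrix.sum_apply, vecMulVec_apply, mul_apply]

lemma trace_mul_conjTranspose {m : ℕ} (A : Matrix n (Fin m) ℂ) :
    (A * Aᴴ).trace = ((∑ k, ∑ l, ‖A k l‖ ^ 2 : ℝ) : ℂ) := by
  simp [trace, mul_apply, Complex.mul_conj, Complex.normSq_eq_norm_sq, -Complex.ofReal_pow]

/-- Cauchy–Schwarz on the rows of a factor `A`. This bound makes trace sublevel sets of the positive
semidefinite cone compact. -/
lemma norm_apply_le_trace {Z : Matrix n n ℂ} (hZ : Z.PosSemidef) (a b : n) :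
    ‖Z a b‖ ≤ Z.trace.re := by
  classical
  obtain ⟨m, A, rfl⟩ := exists_eq_mul_conjTranspose hZ
  rw [trace_mul_conjTranspose, Complex.ofReal_re, mul_apply]
  have hs : ∀ c, ∑ l, ‖A c l‖ ^ 2 ≤ ∑ k, ∑ l, ‖A k l‖ ^ 2 := fun c =>
    Finset.single_le_sum (f := fun k => ∑ l, ‖A k l‖ ^ 2) (fun k _ => by positivity)
      (Finset.mem_univ c)
  have h1 : ‖∑ l, A a l * Aᴴ l b‖ ≤ ∑ l, ‖A a l‖ * ‖A b l‖ :=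
    (norm_sum_le _ _).trans_eq (by simp)
  have h2 : ∑ l, ‖A a l‖ * ‖A b l‖ ≤ ∑ l, (‖A a l‖ ^ 2 + ‖A b l‖ ^ 2) / 2 :=
    Finset.sum_le_sum fun l _ => by nlinarith [sq_nonneg (‖A a l‖ - ‖A b l‖)]
  rw [← Finset.sum_div, Finset.sum_add_distrib] at h2
  linarith [hs a, hs b]

lemma isClosed_posSemidef : IsClosed {Z : Matrix n n ℂ | Z.PosSemidef} := by
  simp only [posSemidef_iff_dotProduct_mulVec, Set.ofPred_and, Set.ofPred_forall]
  refine IsClosed.inter ?_ (isClosed_iInter fun x => ?_)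
  · exact isClosed_eq continuous_id.matrix_conjTranspose continuous_id
  · exact isClosed_le continuous_const
      (continuous_const.dotProduct (continuous_id.matrix_mulVec continuous_const))

lemma isCompact_posSemidef_trace_le (c : ℝ) :
    IsCompact {Z : Matrix n n ℂ | Z.PosSemidef ∧ Z.trace.re ≤ c} := by
  have hK : IsCompact (Set.univ.pi fun _ : n => Set.univ.pi fun _ : n =>
      Metric.closedBall (0 : ℂ) c) :=
    isCompact_univ_pi fun _ => isCompact_univ_pi fun _ => isCompact_closedBall 0 c
  refine hK.of_isClosed_subset ?_ ?_
  · exact isClosed_posSemidef.inter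
      (isClosed_le (Complex.continuous_re.comp continuous_id.matrix_trace) continuous_const)
  · rintro Z ⟨hZ, hc⟩ a - b -
    simpa using (norm_apply_le_trace hZ a b).trans hc

lemma spectral_decomposition [DecidableEq n] {Z : Matrix n n ℂ} (hZ : Z.IsHermitian) :
    Z = (hZ.eigenvectorUnitary : Matrix n n ℂ) * diagonal (fun a => (hZ.eigenvalues a : ℂ)) *
      (hZ.eigenvectorUnitary : Matrix n n ℂ)ᴴ := by
  conv_lhs => rw [hZ.spectral_theorem]
  rfl

/-- With only one positive eigenvalue the spectral decomposition has one term, and the root of the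
eigenvalue is absorbed in the eigenvector. The zero matrix falls in the first case. -/
lemma exists_eq_outer_or_two_le {K : ℕ} {Z : Matrix (Fin K) (Fin K) ℂ} (hZ : Z.PosSemidef) :
    (∃ v, Z = outer v) ∨
      ∃ a b, a ≠ b ∧ 0 < hZ.1.eigenvalues a ∧ 0 < hZ.1.eigenvalues b := by
  refine or_iff_not_imp_right.2 fun hab => ?_
  push Not at hab
  rcases eq_or_ne Z 0 with rfl | hne
  · exact ⟨0, by ext; simp [outer, vecMulVec_apply]⟩
  obtain ⟨a, ha⟩ : ∃ a, hZ.1.eigenvalues a ≠ 0 := by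
    by_contra! h
    exact hne (hZ.1.eigenvalues_eq_zero_iff.1 (funext h))
  have hapos := lt_of_le_of_ne (hZ.eigenvalues_nonneg a) ha.symm
  have hb : ∀ b, b ≠ a → hZ.1.eigenvalues b = 0 := fun b hb =>
    le_antisymm (hab a b hb.symm hapos) (hZ.eigenvalues_nonneg b)
  set U : Matrix (Fin K) (Fin K) ℂ := ↑hZ.1.eigenvectorUnitary
  refine ⟨WithLp.toLp 2 fun k => (√(hZ.1.eigenvalues a) : ℂ) * U k a, ?_⟩
  have hs : ((√(hZ.1.eigenvalues a) : ℝ) : ℂ) * (√(hZ.1.eigenvalues a) : ℝ)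
      = hZ.1.eigenvalues a := by
    rw [← Complex.ofReal_mul, Real.mul_self_sqrt hapos.le]
  conv_lhs => rw [spectral_decomposition hZ.1]
  ext k l
  rw [mul_apply, Finset.sum_eq_single a]
  · simp only [mul_diagonal, conjTranspose_apply, outer, vecMulVec_apply, Pi.star_apply, star_mul',
      RCLike.star_def, Complex.conj_ofReal, ← hs]
    ring
  · intro b _ hba
    simp [hb b hba]
  · simp

lemma outer_of_rank_le_one {K : ℕ} {Z : Matrix (Fin K) (Fin K) ℂ} (hZ : Z.PosSemidef)
    (hr : Z.rank ≤ 1) : ∃ v, Z = outer v := by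
  refine (exists_eq_outer_or_two_le hZ).resolve_right ?_
  rintro ⟨a, b, hab, ha, hb⟩
  rw [hZ.1.rank_eq_card_non_zero_eigs, Fintype.card_le_one_iff] at hr
  exact hab (congrArg Subtype.val (hr ⟨a, ha.ne'⟩ ⟨b, hb.ne'⟩))

end

lemma posSemidef_outer {K : ℕ} (v : EuclideanSpace ℂ (Fin K)) : (outer v).PosSemidef :=
  posSemidef_vecMulVec_self_star _

lemma eq_zero_of_rank_eq_zero {m n : Type*} [Fintype n] {A : Matrix m n ℂ} (hA : A.rank = 0) :
    A = 0 := by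
  classical
  have h0 : A.mulVecLin = 0 := LinearMap.range_eq_bot.1 (Submodule.finrank_eq_zero.1 hA)
  ext a b
  have := congrFun (LinearMap.congr_fun h0 (Pi.single b 1)) a
  simpa using this

lemma rank_outer {K : ℕ} {v : EuclideanSpace ℂ (Fin K)} (hv : outer v ≠ 0) :
    (outer v).rank = 1 := by
  refine le_antisymm (rank_vecMulVec_le _ _) (Nat.one_le_iff_ne_zero.2 fun h => hv ?_)
  exact eq_zero_of_rank_eq_zero h

lemma trace_outer {K : ℕ} (v : EuclideanSpace ℂ (Fin K)) :
    (outer v).trace = ((‖v‖ ^ 2 : ℝ) : ℂ) := by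
  rw [outer, trace_vecMulVec, EuclideanSpace.norm_sq_eq]
  simp [dotProduct, Complex.mul_conj, Complex.normSq_eq_norm_sq, -Complex.ofReal_pow]

/-! ### Gains -/

section

variable {K : ℕ} (h : Channel K) (i j : Fin K)

lemma matGain_eq (W : Matrix (Fin K) (Fin K) ℂ) :
    matGain h i j W = (star (h i j) ⬝ᵥ (h i j ᵥ* W)).re := by
  rw [matGain, vecMulVec_mul, trace_vecMulVec]

lemma matGain_add (W W' : Matrix (Fin K) (Fin K) ℂ) :
    matGain h i j (W + W') = matGain h i j W + matGain h i j W' := by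
  simp [matGain, mul_add]

lemma matGain_smul (t : ℝ) (W : Matrix (Fin K) (Fin K) ℂ) :
    matGain h i j (t • W) = t * matGain h i j W := by
  simp [matGain]

lemma continuous_matGain : Continuous (matGain h i j) :=
  Complex.continuous_re.comp (continuous_const.matrix_mul continuous_id).matrix_trace

lemma matGain_mul_conjTranspose {m : ℕ} (A : Matrix (Fin K) (Fin m) ℂ) :
    matGain h i j (A * Aᴴ) = ∑ l, ‖(h i j ᵥ* A) l‖ ^ 2 := by
  have : star (h i j) ⬝ᵥ (h i j ᵥ* (A * Aᴴ)) = (h i j ᵥ* A) ⬝ᵥ star (h i j ᵥ* A) := by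
    rw [← vecMul_vecMul, dotProduct_comm, ← dotProduct_mulVec, star_vecMul]
  rw [matGain_eq, this]
  simp [dotProduct, Complex.mul_conj, Complex.normSq_eq_norm_sq, -Complex.ofReal_pow]

lemma matGain_outer (v : EuclideanSpace ℂ (Fin K)) :
    matGain h i j (outer v) = beamGain h i j v := by
  have : star (h i j) ⬝ᵥ (h i j ᵥ* outer v) = (h i j ⬝ᵥ v.ofLp) * star (h i j ⬝ᵥ v.ofLp) := by
    rw [outer, vecMul_vecMulVec, dotProduct_smul, ← star_dotProduct_star]
    simp [dotProduct_comm]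
  rw [matGain_eq, this, beamGain]
  simp [Complex.mul_conj, Complex.normSq_eq_norm_sq, -Complex.ofReal_pow]

variable {h i j}

lemma matGain_nonneg {W : Matrix (Fin K) (Fin K) ℂ} (hW : W.PosSemidef) : 0 ≤ matGain h i j W := by
  obtain ⟨m, A, rfl⟩ := exists_eq_mul_conjTranspose hW
  rw [matGain_mul_conjTranspose]
  positivity

end

/-! ### Rank reduction at an extreme point -/

section

variable {n : Type*} [DecidableEq n]

/-- The Hermitian matrices supported on the rows and columns `a`, `b`. -/
def pairHermitian (a b : n) : (ℝ × ℝ × ℂ) →ₗ[ℝ] Matrix n n ℂ where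
  toFun x := single a a (x.1 : ℂ) + single b b (x.2.1 : ℂ) + single a b x.2.2 +
    single b a (star x.2.2)
  map_add' x y := by
    simp only [Prod.fst_add, Prod.snd_add, Complex.ofReal_add, single_add, star_add]
    abel
  map_smul' t x := by
    simp [smul_add, smul_single]

lemma pairHermitian_injective {a b : n} (hab : a ≠ b) :
    Function.Injective (pairHermitian a b) := by
  rw [← LinearMap.ker_eq_bot, LinearMap.ker_eq_bot']
  rintro ⟨p, q, z⟩ hx
  have h1 := congrFun (congrFun hx a) a
  have h2 := congrFun (congrFun hx b) b
  have h3 := congrFun (congrFun hx a) b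
  simp [pairHermitian, hab, hab.symm] at h1 h2 h3
  simp [h1, h2, h3]

variable [Fintype n]

/-- With `z = s ^ 2`, the vector with entries `s` at `a` and `star s` at `b` has an outer product
with off-diagonal entries `z`, `star z` and both diagonal entries `‖z‖`. What remains is diagonal
and nonnegative by the two bounds. -/
lemma posSemidef_diagonal_add_pairHermitian {a b : n} (hab : a ≠ b) {d : n → ℝ} (hd : 0 ≤ d)
    {p q : ℝ} {z : ℂ} (ha : |p| + ‖z‖ ≤ d a) (hb : |q| + ‖z‖ ≤ d b) :
    (diagonal (fun c => (d c : ℂ)) + pairHermitian a b (p, q, z)).PosSemidef := by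
  obtain ⟨s, hs⟩ := IsAlgClosed.exists_pow_nat_eq z (n := 2) two_pos
  have hns : s * star s = (‖z‖ : ℂ) := by
    rw [← hs, norm_pow]
    simp [Complex.mul_conj, Complex.normSq_eq_norm_sq]
  set d' : n → ℝ := fun c => d c + (if c = a then p - ‖z‖ else 0) +
    (if c = b then q - ‖z‖ else 0) with hd'
  set y : n → ℂ := Pi.single a s + Pi.single b (star s) with hy
  have hsum : diagonal (fun c => (d c : ℂ)) + pairHermitian a b (p, q, z) =
      diagonal (fun c => (d' c : ℂ)) + vecMulVec y (star y) := by
    have hss : s * s = z := by rw [← hs]; ring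
    have hss' : star s * star s = star z := by rw [← hss, star_mul']
    ext c e
    by_cases hca : c = a <;> by_cases hcb : c = b <;> by_cases hea : e = a <;>
      by_cases heb : e = b <;> by_cases hce : c = e <;>
      simp_all [pairHermitian, vecMulVec_apply, single_apply, Pi.single_apply, eq_comm,
        mul_comm] <;> ring
  rw [hsum]
  refine .add (.diagonal fun c => ?_) (posSemidef_vecMulVec_self_star y)
  have : 0 ≤ d' c := by
    have h1 := neg_abs_le p
    have h2 := neg_abs_le q
    have h3 := hd c
    simp only [hd', Pi.zero_apply] at h3 ⊢
    split_ifs with h4 h5 h5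
    · exact absurd (h4.symm.trans h5) hab
    · subst h4; linarith
    · subst h5; linarith
    · linarith
  exact Complex.zero_le_real.2 this

lemma exists_perturbation {m : ℕ} (hm : m < 4) {Z : Matrix n n ℂ} (hZ : Z.PosSemidef) {a b : n}
    (hab : a ≠ b) (ha : 0 < hZ.1.eigenvalues a) (hb : 0 < hZ.1.eigenvalues b)
    (L : Fin m → Matrix n n ℂ →ₗ[ℝ] ℝ) :
    ∃ D, D ≠ 0 ∧ (∀ j, L j D = 0) ∧ (Z + D).PosSemidef ∧ (Z - D).PosSemidef := by
  set U : Matrix n n ℂ := ↑hZ.1.eigenvectorUnitary with hU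
  set d := hZ.1.eigenvalues with hd
  have hUU : Uᴴ * U = 1 := Unitary.coe_star_mul_self hZ.1.eigenvectorUnitary
  have hZU : Z = U * diagonal (fun c => (d c : ℂ)) * Uᴴ := spectral_decomposition hZ.1
  let Φ : (ℝ × ℝ × ℂ) →ₗ[ℝ] Matrix n n ℂ :=
    (LinearMap.mulLeft ℝ U) ∘ₗ (LinearMap.mulRight ℝ Uᴴ) ∘ₗ pairHermitian a b
  have hΦ : ∀ x, Φ x = U * pairHermitian a b x * Uᴴ := fun x => by simp [Φ, mul_assoc]
  -- The domain has real dimension 4, more than the `m` functionals, so they have a common nonzero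
  -- zero.
  obtain ⟨x, hx, hx0⟩ := (Submodule.ne_bot_iff _).1 (LinearMap.ker_ne_bot_of_finrank_lt
    (f := LinearMap.pi fun j => (L j).comp Φ) (by simpa using hm))
  have hL : ∀ j, L j (Φ x) = 0 := fun j => congrFun hx j
  obtain ⟨p, q, z⟩ := x
  set c := min (d a) (d b) with hc
  have hcpos : 0 < c := lt_min ha hb
  -- Small enough that the perturbation with either sign stays within the two positive eigenvalues.
  set t := c / (|p| + |q| + ‖z‖ + 1) with ht
  have hden : 0 < |p| + |q| + ‖z‖ + 1 := by positivity
  have htpos : 0 < t := div_pos hcpos hden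
  have htc : t * (|p| + |q| + ‖z‖ + 1) = c := div_mul_cancel₀ _ hden.ne'
  have hpsd : ∀ r : ℝ, |r| = t → (Z + r • Φ (p, q, z)).PosSemidef := by
    intro r hr
    have h1 : |r * p| + ‖(r : ℂ) * z‖ ≤ d a := by
      have := min_le_left (d a) (d b)
      rw [abs_mul, norm_mul, Complex.norm_real, Real.norm_eq_abs, hr]
      nlinarith [abs_nonneg q]
    have h2 : |r * q| + ‖(r : ℂ) * z‖ ≤ d b := by
      have := min_le_right (d a) (d b)
      rw [abs_mul, norm_mul, Complex.norm_real, Real.norm_eq_abs, hr]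
      nlinarith [abs_nonneg p]
    have h3 := posSemidef_diagonal_add_pairHermitian hab (d := d)
      (fun c => hZ.eigenvalues_nonneg c) h1 h2
    have h4 : ((r * p, r * q, (r : ℂ) * z) : ℝ × ℝ × ℂ) = r • (p, q, z) := by simp
    rw [h4, map_smul] at h3
    have h5 := h3.mul_mul_conjTranspose_same U
    rw [mul_add, add_mul, ← hZU, mul_smul_comm, smul_mul_assoc, ← hΦ] at h5
    exact h5
  refine ⟨t • Φ (p, q, z), fun h0 => hx0 ?_, fun j => by rw [map_smul, hL, smul_zero],
    hpsd t (abs_of_pos htpos), ?_⟩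
  · have h1 : Φ (p, q, z) = 0 := (smul_eq_zero.1 h0).resolve_left htpos.ne'
    have h2 : Uᴴ * Φ (p, q, z) * U = pairHermitian a b (p, q, z) := by
      rw [hΦ]
      simp only [mul_assoc, hUU, mul_one]
      rw [← mul_assoc, hUU, one_mul]
    rw [h1, mul_zero, zero_mul] at h2
    exact pairHermitian_injective hab (by rw [← h2, map_zero])
  · have := hpsd (-t) (by rw [abs_neg, abs_of_pos htpos])
    rwa [neg_smul, ← sub_eq_add_neg] at this

end

/-! ### Extreme points among matrices with equal gains -/

section

variable {K : ℕ}

/-- `matGain` as a real-linear functional. -/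
def gainFunctional (h : Channel K) (i j : Fin K) : Matrix (Fin K) (Fin K) ℂ →ₗ[ℝ] ℝ where
  toFun := matGain h i j
  map_add' := matGain_add h i j
  map_smul' := matGain_smul h i j

/-- The positive semidefinite matrices with the gains and the trace of `W`. -/
def sameGains (h : Channel K) (i : Fin K) (W : Matrix (Fin K) (Fin K) ℂ) :
    Set (Matrix (Fin K) (Fin K) ℂ) :=
  {Z | Z.PosSemidef ∧ (∀ j, matGain h j i Z = matGain h j i W) ∧ Z.trace.re = W.trace.re}

lemma isCompact_sameGains (h : Channel K) (i : Fin K) (W : Matrix (Fin K) (Fin K) ℂ) :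
    IsCompact (sameGains h i W) := by
  refine (isCompact_posSemidef_trace_le W.trace.re).of_isClosed_subset ?_
    fun Z hZ => ⟨hZ.1, hZ.2.2.le⟩
  have hg : IsClosed {Z | ∀ j, matGain h j i Z = matGain h j i W} := by
    simp only [Set.ofPred_forall]
    exact isClosed_iInter fun j => isClosed_eq (continuous_matGain h j i) continuous_const
  refine isClosed_posSemidef.inter (hg.inter ?_)
  exact isClosed_eq (Complex.continuous_re.comp continuous_id.matrix_trace) continuous_const

instance : LocallyConvexSpace ℝ (Matrix (Fin K) (Fin K) ℂ) :=
  inferInstanceAs (LocallyConvexSpace ℝ (Fin K → Fin K → ℂ))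

lemma exists_outer_mem_sameGains (hK : K < 4) {h : Channel K} {i : Fin K}
    {W : Matrix (Fin K) (Fin K) ℂ} (hW : W.PosSemidef)
    (hmin : ∀ Z : Matrix (Fin K) (Fin K) ℂ, Z.PosSemidef →
      (∀ j, matGain h j i Z = matGain h j i W) → W.trace.re ≤ Z.trace.re) :
    ∃ v, outer v ∈ sameGains h i W := by
  obtain ⟨Z, hZ⟩ := (isCompact_sameGains h i W).extremePoints_nonempty ⟨W, hW, fun _ => rfl, rfl⟩
  obtain ⟨⟨hZp, hZg, hZt⟩, hext⟩ := hZ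
  rcases exists_eq_outer_or_two_le hZp with ⟨v, rfl⟩ | ⟨a, b, hab, ha, hb⟩
  · exact ⟨v, hZp, hZg, hZt⟩
  exfalso
  obtain ⟨D, hD0, hDg, hp, hm⟩ :=
    exists_perturbation hK hZp hab ha hb fun j => gainFunctional h j i
  have hg1 : ∀ j, matGain h j i (Z + D) = matGain h j i W := fun j => by
    have : matGain h j i D = 0 := hDg j
    rw [matGain_add, this, add_zero, hZg]
  have hg2 : ∀ j, matGain h j i (Z - D) = matGain h j i W := fun j => by
    have := (gainFunctional h j i).map_sub Z D
    rw [hDg j, sub_zero] at this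
    exact this.trans (hZg j)
  have ht1 := hmin _ hp hg1
  have ht2 := hmin _ hm hg2
  rw [trace_add, Complex.add_re, hZt] at ht1
  rw [trace_sub, Complex.sub_re, hZt] at ht2
  have hDt : D.trace.re = 0 := by linarith
  have hmem1 : Z + D ∈ sameGains h i W := ⟨hp, hg1, by simp [hZt, hDt]⟩
  have hmem2 : Z - D ∈ sameGains h i W := ⟨hm, hg2, by simp [hZt, hDt]⟩
  have hseg : Z ∈ openSegment ℝ (Z + D) (Z - D) := by
    refine ⟨1 / 2, 1 / 2, by norm_num, by norm_num, by norm_num, ?_⟩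
    rw [← smul_add, add_add_sub_cancel, ← two_smul ℝ Z, smul_smul]
    norm_num
  exact hD0 (by simpa using hext hmem1 hmem2 hseg)

end

/-! ### Rank of the minimizers for generic channels -/

section

variable {E : Type*} [NormedAddCommGroup E] [InnerProductSpace ℂ E]

/-- Equality case of Cauchy–Schwarz: a real-linear form is least on a sphere at the point opposite
to its gradient `s`. The form without division also covers `s = 0`. -/
lemma norm_smul_eq_of_forall_re_inner_le {r s : E}
    (hmin : ∀ r' : E, ‖r'‖ = ‖r‖ → (inner ℂ s r).re ≤ (inner ℂ s r').re) :
    (‖s‖ : ℂ) • r = -(‖r‖ : ℂ) • s := by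
  rcases eq_or_ne s 0 with rfl | hs
  · simp
  have hs' : ‖s‖ ≠ 0 := norm_ne_zero_iff.2 hs
  have h1 := hmin (-((‖r‖ / ‖s‖ : ℝ) : ℂ) • s) (by
    rw [norm_smul, norm_neg, Complex.norm_real, Real.norm_eq_abs, abs_of_nonneg (by positivity),
      div_mul_cancel₀ _ hs'])
  rw [inner_smul_right, inner_self_eq_norm_sq_to_K] at h1
  have h2 : (inner ℂ s r).re ≤ -(‖r‖ * ‖s‖) := by
    refine h1.trans_eq ?_
    have : -((‖r‖ / ‖s‖ : ℝ) : ℂ) * ((‖s‖ : ℝ) : ℂ) ^ 2 = ((-(‖r‖ * ‖s‖) : ℝ) : ℂ) := by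
      rw [← Complex.ofReal_pow, ← Complex.ofReal_neg, ← Complex.ofReal_mul]
      congr 1
      field_simp
    exact (congrArg Complex.re this).trans (Complex.ofReal_re _)
  have h3 : ‖(‖s‖ : ℂ) • r + (‖r‖ : ℂ) • s‖ ^ 2 ≤ 0 := by
    rw [norm_add_sq (𝕜 := ℂ), inner_smul_left, inner_smul_right, norm_smul, norm_smul]
    have h4 : RCLike.re ((starRingEnd ℂ) (‖s‖ : ℂ) * ((‖r‖ : ℂ) * inner ℂ r s)) =
        ‖s‖ * ‖r‖ * (inner ℂ s r).re := by
      rw [Complex.conj_ofReal, ← mul_assoc, ← Complex.ofReal_mul]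
      exact (Complex.re_ofReal_mul _ _).trans (congrArg _ (inner_re_symm (𝕜 := ℂ) r s))
    rw [h4]
    simp only [Complex.norm_real, norm_norm]
    nlinarith [mul_nonneg (norm_nonneg r) (norm_nonneg s)]
  have h5 : (‖s‖ : ℂ) • r + (‖r‖ : ℂ) • s = 0 := by
    rw [← norm_eq_zero]
    exact pow_eq_zero_iff (two_ne_zero) |>.1 (le_antisymm h3 (by positivity))
  rw [neg_smul]
  exact eq_neg_of_add_eq_zero_left h5

variable {n : Type*} [Fintype n] [DecidableEq n]

/-- First-order condition for minimizing `∑ ‖∑ F k j • R j‖²` over vectors of given norms. -/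
lemma gram_smul_eq_of_isMin (F : Matrix n n ℂ) (R : n → E)
    (hmin : ∀ R' : n → E, (∀ j, ‖R' j‖ = ‖R j‖) →
      ∑ k, ‖∑ j, F k j • R j‖ ^ 2 ≤ ∑ k, ‖∑ j, F k j • R' j‖ ^ 2) (j : n) :
    R j = 0 ∨ ∃ ν : ℝ, ∑ l, (Fᴴ * F) j l • R l = (ν : ℂ) • R j := by
  refine or_iff_not_imp_left.2 fun hj => ?_
  set A : n → E := fun k => ∑ l, F k l • R l with hA
  set c : ℝ := ∑ k, ‖F k j‖ ^ 2 with hc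
  have hy : ∑ l, (Fᴴ * F) j l • R l = ∑ k, star (F k j) • A k := by
    simp only [hA, mul_apply, conjTranspose_apply, Finset.sum_smul, Finset.smul_sum, smul_smul]
    exact Finset.sum_comm
  set y : E := ∑ k, star (F k j) • A k with hydef
  -- Only the `j`-th vector varies, by `δ`. Staying on the sphere means `‖δ‖ ^ 2 = -2 Re ⟪R j, δ⟫`,
  -- so the quadratic term becomes linear and the objective changes by exactly twice `Re ⟪y - c • R
  -- j, δ⟫`.
  have key := norm_smul_eq_of_forall_re_inner_le (r := R j) (s := y - (c : ℂ) • R j) ?_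
  · have hr : ‖R j‖ ≠ 0 := norm_ne_zero_iff.2 hj
    refine ⟨c - ‖y - (c : ℂ) • R j‖ / ‖R j‖, ?_⟩
    rw [hy]
    have h1 : y - (c : ℂ) • R j = -((‖y - (c : ℂ) • R j‖ / ‖R j‖ : ℝ) : ℂ) • R j := by
      have hr' : (‖R j‖ : ℂ) ≠ 0 := by exact_mod_cast hr
      rw [Complex.ofReal_div, div_eq_inv_mul, ← mul_neg, mul_smul, neg_smul, key, neg_smul,
        neg_neg, smul_smul, inv_mul_cancel₀ hr', one_smul]
    rw [Complex.ofReal_sub, sub_smul, ← neg_add_eq_sub, ← neg_smul, ← h1]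
    abel
  · intro r' hr'
    set δ := r' - R j with hδ
    have hup := hmin (Function.update R j r') (fun l => by
      by_cases hl : l = j
      · subst hl; simpa using hr'
      · simp [hl])
    have hsum : ∀ k, ∑ l, F k l • Function.update R j r' l = A k + F k j • δ := by
      intro k
      have : Function.update R j r' = R + Pi.single j δ := by
        ext l
        by_cases hl : l = j
        · subst hl; simp [hδ]
        · simp [hl]
      rw [this]
      simp only [Pi.add_apply, smul_add, Finset.sum_add_distrib, hA]
      congr 1
      rw [Finset.sum_eq_single j]
      · simp
      · intro l _ hl; simp [hl]
      · simp
    simp only [hsum] at hup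
    have hexp : ∑ k, ‖A k + F k j • δ‖ ^ 2 =
        ∑ k, ‖A k‖ ^ 2 + 2 * (inner ℂ y δ).re + c * ‖δ‖ ^ 2 := by
      have h1 : (inner ℂ y δ).re = ∑ k, (inner ℂ (A k) (F k j • δ)).re := by
        rw [hydef, sum_inner, Complex.re_sum]
        refine Finset.sum_congr rfl fun k _ => ?_
        rw [inner_smul_left, inner_smul_right]
        simp
      rw [h1, hc, Finset.mul_sum, Finset.sum_mul, ← Finset.sum_add_distrib,
        ← Finset.sum_add_distrib]
      refine Finset.sum_congr rfl fun k _ => ?_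
      rw [norm_add_sq (𝕜 := ℂ), norm_smul, mul_pow]
      rfl
    rw [hexp] at hup
    have hn : ‖δ‖ ^ 2 = -2 * (inner ℂ (R j) δ).re := by
      have h1 : ‖R j + δ‖ ^ 2 = ‖R j‖ ^ 2 := by rw [hδ, add_sub_cancel, hr']
      rw [norm_add_sq (𝕜 := ℂ)] at h1
      have h2 : RCLike.re (inner ℂ (R j) δ) = (inner ℂ (R j) δ).re := rfl
      linarith
    have hdiff : (inner ℂ (y - (c : ℂ) • R j) r').re - (inner ℂ (y - (c : ℂ) • R j) (R j)).re =
        (inner ℂ y δ).re - c * (inner ℂ (R j) δ).re := by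
      rw [← Complex.sub_re, ← inner_sub_right, ← hδ, inner_sub_left, inner_smul_left]
      simp
    have : 0 ≤ 2 * (inner ℂ y δ).re + c * ‖δ‖ ^ 2 := by linarith
    rw [hn] at this
    linarith

end

/-! ### Collinearity forced by the stationarity equations -/

section

variable {E : Type*} [NormedAddCommGroup E] [InnerProductSpace ℂ E]

lemma exists_eq_smul_of_gram_two {N : Matrix (Fin 2) (Fin 2) ℂ} (h01 : N 0 1 ≠ 0) {R : Fin 2 → E}
    (hR : ∀ j, R j = 0 ∨ ∃ ν : ℝ, ∑ l, N j l • R l = (ν : ℂ) • R j) :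
    ∃ (c : Fin 2 → ℂ) (e : E), ∀ j, R j = c j • e := by
  rcases hR 0 with h0 | ⟨ν, h0⟩
  · exact ⟨![0, 1], R 1, fun j => by fin_cases j <;> simp [h0]⟩
  · rw [Fin.sum_univ_two] at h0
    have h1 : N 0 1 • R 1 = ((ν : ℂ) - N 0 0) • R 0 := by rw [sub_smul, ← h0]; abel
    refine ⟨![1, (N 0 1)⁻¹ * ((ν : ℂ) - N 0 0)], R 0, fun j => ?_⟩
    fin_cases j
    · simp
    · simp [mul_smul, ← h1, smul_smul, inv_mul_cancel₀ h01]

/-- If `R 0` or `R 1` vanishes, one remaining equation suffices. Otherwise eliminate `R 2` from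
equations 0 and 1 to express `R 1` through `R 0`, then recover `R 2` from equation 0. Equation 2 is
never needed. -/
lemma exists_eq_smul_of_gram_three {N : Matrix (Fin 3) (Fin 3) ℂ} (hN : N.IsHermitian)
    (him : (N 0 1 * N 1 2 * N 2 0).im ≠ 0) {R : Fin 3 → E}
    (hR : ∀ j, R j = 0 ∨ ∃ ν : ℝ, ∑ l, N j l • R l = (ν : ℂ) • R j) :
    ∃ (c : Fin 3 → ℂ) (e : E), ∀ j, R j = c j • e := by
  have h01 : N 0 1 ≠ 0 := fun h => him (by simp [h])
  have h12 : N 1 2 ≠ 0 := fun h => him (by simp [h])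
  have h20 : N 2 0 = star (N 0 2) := (hN.apply 2 0).symm
  have h02 : N 0 2 ≠ 0 := fun h => him (by simp [h20, h])
  have h11 : star (N 1 1) = N 1 1 := hN.apply 1 1
  have solve : ∀ {α β : ℂ} {x y : E}, β ≠ 0 → β • y = α • x → y = (β⁻¹ * α) • x := by
    intro α β x y hβ hxy
    rw [mul_smul, ← hxy, smul_smul, inv_mul_cancel₀ hβ, one_smul]
  rcases hR 1 with h1 | ⟨ν₁, h1⟩
  · rcases hR 0 with h0 | ⟨ν₀, h0⟩
    · exact ⟨![0, 0, 1], R 2, fun j => by fin_cases j <;> simp [h0, h1]⟩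
    · rw [Fin.sum_univ_three, h1, smul_zero, add_zero] at h0
      have h2 := solve (α := ν₀ - N 0 0) (x := R 0) h02 (by rw [sub_smul, ← h0]; abel)
      exact ⟨![1, 0, _], R 0, fun j => by
        fin_cases j
        · simp
        · simp [h1]
        · exact h2⟩
  rw [Fin.sum_univ_three] at h1
  rcases hR 0 with h0 | ⟨ν₀, h0⟩
  · rw [h0, smul_zero, zero_add] at h1
    have h2 := solve (α := ν₁ - N 1 1) (x := R 1) h12 (by rw [sub_smul, ← h1]; abel)
    exact ⟨![0, 1, _], R 1, fun j => by
      fin_cases j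
      · simp [h0]
      · simp
      · exact h2⟩
  rw [Fin.sum_univ_three] at h0
  -- Were this coefficient of `R 1` zero, multiplying by `star (N 0 2)` would make the cyclic
  -- product equal to the real number `(N 1 1 - ν₁) * ‖N 0 2‖ ^ 2`.
  have hβ : N 1 2 * N 0 1 - N 0 2 * (N 1 1 - ν₁) ≠ 0 := by
    intro h
    refine him ?_
    have h3 : N 0 1 * N 1 2 * N 2 0 = (N 1 1 - ν₁) * (N 0 2 * star (N 0 2)) := by
      rw [h20]; linear_combination star (N 0 2) * h
    rw [h3]
    refine Complex.conj_eq_iff_im.1 ?_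
    change star _ = _
    simp only [star_mul', star_sub, h11, star_star]
    simp [mul_comm]
  have h4 := solve (α := -(N 1 2 * (N 0 0 - ν₀) - N 0 2 * N 1 0)) (x := R 0) (y := R 1) hβ (by
    have e0 : (N 0 0 - ν₀) • R 0 + N 0 1 • R 1 + N 0 2 • R 2 = 0 := by
      rw [sub_smul, ← h0]; abel
    have e1 : N 1 0 • R 0 + (N 1 1 - ν₁) • R 1 + N 1 2 • R 2 = 0 := by
      rw [sub_smul, ← h1]; abel
    have e2 := congrArg₂ (fun x y => N 1 2 • x - N 0 2 • y) e0 e1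
    simp only [smul_zero, sub_zero] at e2
    rw [← sub_eq_zero, ← e2]
    module)
  have h5 := solve (α := ν₀ - N 0 0 - N 0 1 * _) (x := R 0) (y := R 2) h02 (by
    rw [sub_smul, sub_smul, mul_smul, ← h4, ← h0]; abel)
  exact ⟨![1, _, _], R 0, fun j => by
    fin_cases j
    · simp
    · exact h4
    · exact h5⟩

end

/-! ### From stationarity to rank one -/

section

variable {K : ℕ}

/-- Rows of a matrix as Euclidean vectors. -/
def euclideanRow {m : ℕ} (A : Matrix (Fin K) (Fin m) ℂ) (k : Fin K) : EuclideanSpace ℂ (Fin m) :=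
  WithLp.toLp 2 (A k)

lemma euclideanRow_mul {m : ℕ} (F : Matrix (Fin K) (Fin K) ℂ) (A : Matrix (Fin K) (Fin m) ℂ)
    (k : Fin K) : euclideanRow (F * A) k = ∑ j, F k j • euclideanRow A j := by
  ext l
  simp [euclideanRow, mul_apply]

lemma trace_re_mul_conjTranspose {m : ℕ} (A : Matrix (Fin K) (Fin m) ℂ) :
    (A * Aᴴ).trace.re = ∑ k, ‖euclideanRow A k‖ ^ 2 := by
  simp only [trace_mul_conjTranspose, Complex.ofReal_re, EuclideanSpace.norm_sq_eq, euclideanRow]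

lemma matGain_eq_norm_euclideanRow {m : ℕ} (h : Channel K) (i j : Fin K)
    (A : Matrix (Fin K) (Fin m) ℂ) :
    matGain h j i (A * Aᴴ) = ‖euclideanRow (sourceMatrix h i * A) j‖ ^ 2 := by
  rw [matGain_mul_conjTranspose, EuclideanSpace.norm_sq_eq]
  rfl

lemma rank_le_one_of_isMin {h : Channel K} {i : Fin K} (hdet : (sourceMatrix h i).det ≠ 0)
    (hcol : ∀ {m : ℕ} (R : Fin K → EuclideanSpace ℂ (Fin m)),
      (∀ j, R j = 0 ∨ ∃ ν : ℝ, ∑ l, adjugateGram (sourceMatrix h i) j l • R l = (ν : ℂ) • R j) →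
      ∃ (c : Fin K → ℂ) (e : EuclideanSpace ℂ (Fin m)), ∀ j, R j = c j • e)
    {W : Matrix (Fin K) (Fin K) ℂ} (hW : W.PosSemidef)
    (hmin : ∀ Z : Matrix (Fin K) (Fin K) ℂ, Z.PosSemidef →
      (∀ j, matGain h j i Z = matGain h j i W) → W.trace.re ≤ Z.trace.re) : W.rank ≤ 1 := by
  obtain ⟨m, A, rfl⟩ := exists_eq_mul_conjTranspose hW
  set H := sourceMatrix h i with hH
  set F := H⁻¹ with hF
  have hHF : H * F = 1 := mul_nonsing_inv H (isUnit_iff_ne_zero.2 hdet)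
  have hFH : F * H = 1 := nonsing_inv_mul H (isUnit_iff_ne_zero.2 hdet)
  have hFA : F * (H * A) = A := by
    rw [← Matrix.mul_assoc, hFH, Matrix.one_mul]
  -- The adjugate is polynomial in the channel, unlike the inverse; the real factor between the Gram
  -- matrices is absorbed in `ν`.
  have hgram : adjugateGram H = (Complex.normSq H.det : ℂ) • (Fᴴ * F) := by
    have hadj : H.adjugate = H.det • F := by
      rw [← one_mul H.adjugate, ← hFH, mul_assoc, mul_adjugate, mul_smul_comm, mul_one]
    rw [adjugateGram, hadj, conjTranspose_smul, smul_mul_smul_comm, Complex.normSq_eq_conj_mul_self]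
    rfl
  have hstat := gram_smul_eq_of_isMin F (euclideanRow (H * A)) fun R' hR' => by
    set B : Matrix (Fin K) (Fin m) ℂ := .of fun j => (R' j).ofLp with hB
    have hBR : ∀ j, euclideanRow B j = R' j := fun j => rfl
    have h1 := hmin ((F * B) * (F * B)ᴴ) (posSemidef_self_mul_conjTranspose _) fun j => by
      rw [matGain_eq_norm_euclideanRow, matGain_eq_norm_euclideanRow, ← hH, ← Matrix.mul_assoc,
        hHF, Matrix.one_mul, hBR, hR']
    rw [trace_re_mul_conjTranspose, trace_re_mul_conjTranspose] at h1
    simp only [euclideanRow_mul F, hBR] at h1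
    rw [← hFA] at h1
    simpa only [euclideanRow_mul F (H * A)] using h1
  obtain ⟨c, e, hce⟩ := hcol (euclideanRow (H * A)) fun j => by
    refine (hstat j).imp id ?_
    rintro ⟨ν, hν⟩
    refine ⟨Complex.normSq H.det * ν, ?_⟩
    simp only [hgram, Matrix.smul_apply, smul_assoc, ← Finset.smul_sum, hν]
    rw [Complex.ofReal_mul, mul_smul]
  have hHA : H * A = vecMulVec c e.ofLp := by
    ext j l
    exact congrArg (fun v : EuclideanSpace ℂ (Fin m) => v.ofLp l) (hce j)
  calc (A * Aᴴ).rank ≤ A.rank := rank_mul_le_left _ _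
    _ = (F * (H * A)).rank := by rw [hFA]
    _ ≤ (H * A).rank := rank_mul_le_right _ _
    _ ≤ 1 := by rw [hHA]; exact rank_vecMulVec_le _ _

end

/-! ### The two programs -/

section

variable {K : ℕ} {p : Params K} {h : Channel K}

lemma matGain_update {x : Fin K → Matrix (Fin K) (Fin K) ℂ} {i : Fin K}
    {Z : Matrix (Fin K) (Fin K) ℂ} (hZ : ∀ j, matGain h j i Z = matGain h j i (x i))
    (a b : Fin K) : matGain h a b (Function.update x i Z b) = matGain h a b (x b) := by
  by_cases hb : b = i
  · subst hb; simpa using hZ a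
  · simp [hb]

lemma update_mem_sdpFeasible {x : SdpPoint K} (hx : x ∈ sdpFeasible p h) {i : Fin K}
    {Z : Matrix (Fin K) (Fin K) ℂ} (hZp : Z.PosSemidef)
    (hZ : ∀ j, matGain h j i Z = matGain h j i (x.1 i)) :
    (Function.update x.1 i Z, x.2) ∈ sdpFeasible p h := by
  intro a
  obtain ⟨hA, hB, hW, hρ⟩ := hx a
  refine ⟨?_, ?_, ?_, hρ⟩
  · simpa only [matA, matGain_update hZ] using hA
  · simpa only [matB, matGain_update hZ] using hB
  · by_cases ha : a = i
    · subst ha; simpa using hZp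
    · simpa [ha] using hW

lemma sdpObjective_update (x : SdpPoint K) (i : Fin K) (Z : Matrix (Fin K) (Fin K) ℂ) :
    sdpObjective (Function.update x.1 i Z, x.2) =
      sdpObjective x + (Z.trace.re - (x.1 i).trace.re) := by
  have h1 : ∀ a, (Function.update x.1 i Z a).trace.re =
      (x.1 a).trace.re + if a = i then Z.trace.re - (x.1 i).trace.re else 0 := by
    intro a
    by_cases ha : a = i
    · subst ha; simp
    · simp [ha]
  simp only [sdpObjective, h1, Finset.sum_add_distrib]
  simp

lemma SdpOptimal.trace_le {x : SdpPoint K} (hx : SdpOptimal p h x) (i : Fin K)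
    {Z : Matrix (Fin K) (Fin K) ℂ} (hZp : Z.PosSemidef)
    (hZ : ∀ j, matGain h j i Z = matGain h j i (x.1 i)) : (x.1 i).trace.re ≤ Z.trace.re := by
  have h1 := isMinOn_iff.1 hx.2 _ (update_mem_sdpFeasible hx.1 hZp hZ)
  rw [sdpObjective_update] at h1
  linarith

lemma SdpOptimal.update {x : SdpPoint K} (hx : SdpOptimal p h x) {i : Fin K}
    {Z : Matrix (Fin K) (Fin K) ℂ} (hZ : Z ∈ sameGains h i (x.1 i)) :
    SdpOptimal p h (Function.update x.1 i Z, x.2) := by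
  refine ⟨update_mem_sdpFeasible hx.1 hZ.1 hZ.2.1, fun y hy => ?_⟩
  have h1 : sdpObjective x ≤ sdpObjective y := hx.2 hy
  have h2 := sdpObjective_update x i Z
  rw [hZ.2.2, sub_self, add_zero] at h2
  exact h2.trans_le h1

/-- The nonzero off-diagonal entry `σC` forces a positive diagonal in the first constraint matrix.
Hence no feasible `W i` vanishes, and rank at most one means rank one. -/
lemma matGain_self_pos (hp : p.Admissible) {x : SdpPoint K} (hx : x ∈ sdpFeasible p h)
    (i : Fin K) : 0 < matGain h i i (x.1 i) := by
  obtain ⟨h1, -, h3⟩ := posSemidef_two_iff.1 (hx i).1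
  have hσ : 0 < p.σC ^ 2 := pow_pos hp.σC_pos 2
  have hI : 0 ≤ ∑ j ∈ Finset.univ.erase i, matGain h i j (x.1 j) :=
    Finset.sum_nonneg fun j _ => matGain_nonneg (hx j).2.2.1
  have h4 : 0 < 1 / p.γ i * matGain h i i (x.1 i) := by
    refine lt_of_le_of_ne (by nlinarith [sq_nonneg p.σ]) fun h0 => ?_
    nlinarith [sq_nonneg p.σ, (hx i).2.2.2.1, (hx i).2.2.2.2]
  exact pos_of_mul_pos_right h4 (by have := hp.γ_pos i; positivity)

lemma ne_zero_of_matGain_pos {i j : Fin K} {W : Matrix (Fin K) (Fin K) ℂ}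
    (hW : 0 < matGain h i j W) : W ≠ 0 := by
  rintro rfl
  simp [matGain] at hW

lemma trace_eq_ofReal {W : Matrix (Fin K) (Fin K) ℂ} (hW : W.PosSemidef) :
    W.trace = (W.trace.re : ℂ) := by
  have := Complex.le_def.1 hW.trace_nonneg
  exact Complex.ext rfl (by simpa using this.2.symm)

lemma SdpOptimal.exists_outer (hK : K < 4) (hp : p.Admissible) {x : SdpPoint K}
    (hx : SdpOptimal p h x) (i : Fin K) :
    ∃ v : EuclideanSpace ℂ (Fin K), (outer v).rank = 1 ∧
      (x.1 i).trace = ((‖v‖ ^ 2 : ℝ) : ℂ) ∧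
      (∀ j, matGain h j i (x.1 i) = beamGain h j i v) ∧
      SdpOptimal p h (Function.update x.1 i (outer v), x.2) := by
  obtain ⟨v, hv⟩ := exists_outer_mem_sameGains hK (hx.1 i).2.2.1 fun Z => hx.trace_le i
  have hpos : 0 < matGain h i i (outer v) := by
    rw [hv.2.1 i]; exact matGain_self_pos hp hx.1 i
  refine ⟨v, rank_outer (ne_zero_of_matGain_pos hpos), ?_, fun j => ?_, hx.update hv⟩
  · rw [← trace_outer, trace_eq_ofReal (hx.1 i).2.2.1, trace_eq_ofReal hv.1, hv.2.2]
  · rw [← hv.2.1 j, matGain_outer]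

lemma isClosed_sdpFeasible : IsClosed (sdpFeasible p h) := by
  have hg : ∀ i j, Continuous fun x : SdpPoint K => matGain h i j (x.1 j) := fun i j =>
    (continuous_matGain h i j).comp ((continuous_apply j).comp continuous_fst)
  have hρ : ∀ i, Continuous fun x : SdpPoint K => x.2 i := fun i =>
    (continuous_apply i).comp continuous_snd
  have hW : ∀ i, Continuous fun x : SdpPoint K => x.1 i := fun i =>
    (continuous_apply i).comp continuous_fst
  simp only [sdpFeasible, matA, matB, posSemidef_two_iff]
  simp only [Set.ofPred_forall, Set.ofPred_and]
  refine isClosed_iInter fun i => ?_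
  have hI : Continuous fun x : SdpPoint K => ∑ j ∈ Finset.univ.erase i, matGain h i j (x.1 j) :=
    continuous_finsetSum _ fun j _ => hg i j
  have hS : Continuous fun x : SdpPoint K => ∑ j, matGain h i j (x.1 j) :=
    continuous_finsetSum _ fun j _ => hg i j
  have ha : Continuous fun x : SdpPoint K => 1 / p.γ i * matGain h i i (x.1 i)
      - ∑ j ∈ Finset.univ.erase i, matGain h i j (x.1 j) - p.σ ^ 2 :=
    ((continuous_const.mul (hg i i)).sub hI).sub continuous_const
  have hb := hS.add (continuous_const (y := p.σ ^ 2))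
  have hρ' := (continuous_const (y := (1 : ℝ))).sub (hρ i)
  refine .inter ?_ (.inter ?_ (.inter (isClosed_posSemidef.preimage (hW i)) (.inter ?_ ?_)))
  · exact (isClosed_le continuous_const ha).inter ((isClosed_le continuous_const (hρ i)).inter
      (isClosed_le continuous_const (ha.mul (hρ i))))
  · exact (isClosed_le continuous_const hb).inter ((isClosed_le continuous_const hρ').inter
      (isClosed_le continuous_const (hb.mul hρ')))
  · exact isClosed_le continuous_const (hρ i)
  · exact isClosed_le (hρ i) continuous_const

lemma continuous_sdpObjective : Continuous (sdpObjective (K := K)) :=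
  continuous_finsetSum _ fun i _ =>
    Complex.continuous_re.comp ((continuous_apply i).comp continuous_fst).matrix_trace

lemma exists_sdpOptimal (hne : (sdpFeasible p h).Nonempty) : ∃ x, SdpOptimal p h x := by
  obtain ⟨x₀, hx₀⟩ := hne
  set c := sdpObjective x₀
  -- Traces of positive semidefinite matrices are nonnegative, so a bound on their sum bounds each
  -- one.
  have hC : IsCompact (sdpFeasible p h ∩ {x | sdpObjective x ≤ c}) := by
    have hbox : IsCompact ((Set.univ.pi fun _ : Fin K =>
        {Z : Matrix (Fin K) (Fin K) ℂ | Z.PosSemidef ∧ Z.trace.re ≤ c}) ×ˢ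
        (Set.univ.pi fun _ : Fin K => Set.Icc (0 : ℝ) 1)) :=
      (isCompact_univ_pi fun _ => isCompact_posSemidef_trace_le c).prod
        (isCompact_univ_pi fun _ => isCompact_Icc)
    refine hbox.of_isClosed_subset
      (isClosed_sdpFeasible.inter (isClosed_le continuous_sdpObjective continuous_const)) ?_
    rintro x ⟨hx, hxc⟩
    refine ⟨fun i _ => ⟨(hx i).2.2.1, le_trans ?_ hxc⟩, fun i _ => (hx i).2.2.2⟩
    exact Finset.single_le_sum (f := fun i => (x.1 i).trace.re)
      (fun j _ => (Complex.le_def.1 (hx j).2.2.1.trace_nonneg).1) (Finset.mem_univ i)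
  obtain ⟨x, hx, hmin⟩ := hC.exists_isMinOn ⟨x₀, hx₀, le_refl c⟩
    continuous_sdpObjective.continuousOn
  refine ⟨x, hx.1, fun y hy => ?_⟩
  by_cases hyc : sdpObjective y ≤ c
  · exact hmin ⟨hy, hyc⟩
  · exact hx.2.trans (not_le.1 hyc).le

lemma exists_sdpOptimal_outer (hK : K < 4) (hp : p.Admissible)
    (hne : (sdpFeasible p h).Nonempty) :
    ∃ (v : Fin K → EuclideanSpace ℂ (Fin K)) (ρ : Fin K → ℝ),
      SdpOptimal p h (fun i => outer (v i), ρ) := by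
  -- The matrices are replaced one at a time; each replacement keeps optimality and leaves the
  -- others untouched.
  have key : ∀ s : Finset (Fin K), ∃ x, SdpOptimal p h x ∧ ∀ i ∈ s, ∃ v, x.1 i = outer v := by
    intro s
    induction s using Finset.induction_on with
    | empty =>
      obtain ⟨x, hx⟩ := exists_sdpOptimal hne
      exact ⟨x, hx, by simp⟩
    | insert i s _ ih =>
      obtain ⟨x, hx, hs⟩ := ih
      obtain ⟨v, -, -, -, hv⟩ := hx.exists_outer hK hp i
      refine ⟨_, hv, fun a ha => ?_⟩
      by_cases hai : a = i
      · exact ⟨v, by simp [hai]⟩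
      · simpa [hai] using hs a ((Finset.mem_insert.1 ha).resolve_left hai)
  obtain ⟨⟨W, ρ⟩, hx, hW⟩ := key Finset.univ
  choose v hv using fun i => hW i (Finset.mem_univ i)
  have hWv : W = fun i => outer (v i) := funext hv
  exact ⟨v, ρ, hWv ▸ hx⟩

lemma outer_mem_sdpFeasible_iff (hp : p.Admissible) {x : BeamPoint K} :
    ((fun i => outer (x.1 i), x.2) : SdpPoint K) ∈ sdpFeasible p h ↔ x ∈ beamFeasible p h := by
  refine forall_congr' fun i => ?_
  have hγ := hp.γ_pos i
  have hσ : 0 < p.σC ^ 2 := pow_pos hp.σC_pos 2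
  simp only [matA, matB, posSemidef_two_iff, matGain_outer, posSemidef_outer, true_and, sinr]
  have hI : 0 ≤ ∑ j ∈ Finset.univ.erase i, beamGain h i j (x.1 j) :=
    Finset.sum_nonneg fun j _ => sq_nonneg _
  have hS : 0 ≤ ∑ j, beamGain h i j (x.1 j) := Finset.sum_nonneg fun j _ => sq_nonneg _
  generalize beamGain h i i (x.1 i) = g
  generalize ∑ j ∈ Finset.univ.erase i, beamGain h i j (x.1 j) = I at *
  generalize ∑ j, beamGain h i j (x.1 j) = S at *
  generalize x.2 i = r
  rw [Real.sq_sqrt (hp.lam_nonneg i), mul_comm (1 - r)]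
  have hkey : 0 ≤ r → (p.γ i ≤ r * g / (r * (I + p.σ ^ 2) + p.σC ^ 2) ↔
      p.σC ^ 2 ≤ (1 / p.γ i * g - I - p.σ ^ 2) * r) := by
    intro hr
    have hden : 0 < r * (I + p.σ ^ 2) + p.σC ^ 2 := by positivity
    have h1 : p.γ i * ((1 / p.γ i * g - I - p.σ ^ 2) * r) = r * g - p.γ i * (r * (I + p.σ ^ 2)) := by
      field_simp
      ring
    rw [le_div_iff₀ hden, ← mul_le_mul_iff_right₀ (b := p.σC ^ 2) hγ, h1]
    constructor <;> intro h <;> linarith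
  constructor
  · rintro ⟨⟨-, hr, h1⟩, ⟨-, -, h2⟩, -, hr1⟩
    exact ⟨(hkey hr).2 h1, h2, hr, hr1⟩
  · rintro ⟨h1, h2, hr, hr1⟩
    have h3 := (hkey hr).1 h1
    refine ⟨⟨?_, hr, h3⟩, ⟨by positivity, by linarith, h2⟩, hr, hr1⟩
    -- The sign of the Schur entry comes from its product with the splitting ratio being at least
    -- `σC ^ 2 > 0`.
    exact (pos_of_mul_pos_left (hσ.trans_le h3) hr).le

lemma sdpObjective_outer (x : BeamPoint K) :
    sdpObjective ((fun i => outer (x.1 i), x.2) : SdpPoint K) = beamObjective x := by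
  simp only [sdpObjective, beamObjective, trace_outer, Complex.ofReal_re]

lemma SdpOptimal.beamOptimal (hp : p.Admissible) {v : Fin K → EuclideanSpace ℂ (Fin K)}
    {ρ : Fin K → ℝ} (hx : SdpOptimal p h (fun i => outer (v i), ρ)) : BeamOptimal p h (v, ρ) := by
  refine ⟨(outer_mem_sdpFeasible_iff hp (x := (v, ρ))).1 hx.1, fun y hy => ?_⟩
  have h1 := isMinOn_iff.1 hx.2 _ ((outer_mem_sdpFeasible_iff hp).2 hy)
  rw [sdpObjective_outer y] at h1
  exact (sdpObjective_outer (v, ρ)).symm.trans_le h1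

lemma SdpOptimal.rank_eq_one (hp : p.Admissible) {x : SdpPoint K} (hx : SdpOptimal p h x)
    {i : Fin K} (hdet : (sourceMatrix h i).det ≠ 0)
    (hcol : ∀ {m : ℕ} (R : Fin K → EuclideanSpace ℂ (Fin m)),
      (∀ j, R j = 0 ∨ ∃ ν : ℝ, ∑ l, adjugateGram (sourceMatrix h i) j l • R l = (ν : ℂ) • R j) →
      ∃ (c : Fin K → ℂ) (e : EuclideanSpace ℂ (Fin m)), ∀ j, R j = c j • e) :
    (x.1 i).rank = 1 := by
  refine le_antisymm (rank_le_one_of_isMin hdet hcol (hx.1 i).2.2.1 fun Z => hx.trace_le i) ?_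
  exact Nat.one_le_iff_ne_zero.2 fun h0 =>
    ne_zero_of_matGain_pos (matGain_self_pos hp hx.1 i) (eq_zero_of_rank_eq_zero h0)

/-- For almost every channel all matrices of all optimal solutions have rank one. -/
lemma ae_rank_eq_one (hK : K = 2 ∨ K = 3) {s : Fin K → Fin K → ℝ≥0} (hs : ∀ i j, 0 < s i j) :
    ∀ᵐ h ∂rayleighLaw K s, ∀ p : Params K, p.Admissible → ∀ x, SdpOptimal p h x →
      ∀ i, (x.1 i).rank = 1 := by
  rcases hK with rfl | rfl
  · filter_upwards [ae_det_sourceMatrix_ne_zero hs, ae_adjugateGram_two hs] with h h1 h2 p hp x hx i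
    exact hx.rank_eq_one hp (h1 i) fun R => exists_eq_smul_of_gram_two (h2 i)
  · filter_upwards [ae_det_sourceMatrix_ne_zero hs, ae_adjugateGram_three hs]
      with h h1 h2 p hp x hx i
    exact hx.rank_eq_one hp (h1 i) fun R =>
      exists_eq_smul_of_gram_three (isHermitian_conjTranspose_mul_self _) (h2 i)

end

end MisoSWIPT

end

theorem theorem1 (K : ℕ) (hK : K = 2 ∨ K = 3) :
    -- for every channel and every feasible instance
    (∀ (h : MisoSWIPT.Channel K) (p : MisoSWIPT.Params K), p.Admissible →
      -- there is an optimal solution of the SDP with all matrices of rank one, and its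
      -- factors are an optimal solution of the original problem
      ((MisoSWIPT.sdpFeasible p h).Nonempty →
        ∃ (v : Fin K → EuclideanSpace ℂ (Fin K)) (ρ : Fin K → ℝ),
          MisoSWIPT.SdpOptimal p h (fun i => MisoSWIPT.outer (v i), ρ) ∧
          (∀ i, (MisoSWIPT.outer (v i)).rank = 1) ∧
          MisoSWIPT.BeamOptimal p h (v, ρ)) ∧
      -- any optimal solution of the SDP with all matrices of rank one factors, and each
      -- factorization is an optimal solution of the original problem
      (∀ x : MisoSWIPT.SdpPoint K, MisoSWIPT.SdpOptimal p h x → (∀ i, (x.1 i).rank = 1) →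
        (∃ v : Fin K → EuclideanSpace ℂ (Fin K), ∀ i, x.1 i = MisoSWIPT.outer (v i)) ∧
        ∀ v : Fin K → EuclideanSpace ℂ (Fin K), (∀ i, x.1 i = MisoSWIPT.outer (v i)) →
          MisoSWIPT.BeamOptimal p h (v, x.2)) ∧
      -- in any optimal solution of the SDP each matrix can be replaced by one of rank one
      -- that leaves the objective and all the constraints unchanged
      (∀ x : MisoSWIPT.SdpPoint K, MisoSWIPT.SdpOptimal p h x → ∀ i,
        ∃ v : EuclideanSpace ℂ (Fin K),
          (MisoSWIPT.outer v).rank = 1 ∧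
          (x.1 i).trace = ((‖v‖ ^ 2 : ℝ) : ℂ) ∧
          (∀ j, MisoSWIPT.matGain h j i (x.1 i) = MisoSWIPT.beamGain h j i v) ∧
          MisoSWIPT.SdpOptimal p h (Function.update x.1 i (MisoSWIPT.outer v), x.2))) ∧
    -- almost surely under Rayleigh fading, the ranks of all optimal solutions of the SDP
    (∀ s : Fin K → Fin K → NNReal, (∀ i j, 0 < s i j) →
      ∀ᵐ h ∂(MisoSWIPT.rayleighLaw K s), ∀ p : MisoSWIPT.Params K, p.Admissible →
        ∀ x : MisoSWIPT.SdpPoint K, MisoSWIPT.SdpOptimal p h x →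
          (K = 2 → ∀ i, (x.1 i).rank = 1) ∧
          (K = 3 → (∀ i, (x.1 i).rank = 1 ∨ (x.1 i).rank = 2) ∧
            ∀ i j, (x.1 i).rank = 2 → (x.1 j).rank = 2 → i = j)) := by
  have hK4 : K < 4 := by omega
  refine ⟨fun h p hp => ⟨fun hne => ?_, fun x hx hr => ⟨?_, fun v hv => ?_⟩, fun x hx i =>
    hx.exists_outer hK4 hp i⟩, fun s hs => ?_⟩
  · obtain ⟨v, ρ, hx⟩ := MisoSWIPT.exists_sdpOptimal_outer hK4 hp hne
    exact ⟨v, ρ, hx, fun i => MisoSWIPT.rank_outer (MisoSWIPT.ne_zero_of_matGain_pos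
      (MisoSWIPT.matGain_self_pos hp hx.1 i)), hx.beamOptimal hp⟩
  · choose v hv using fun i => MisoSWIPT.outer_of_rank_le_one (hx.1 i).2.2.1 (hr i).le
    exact ⟨v, hv⟩
  · have hx' : x = (fun i => MisoSWIPT.outer (v i), x.2) := Prod.ext (funext hv) rfl
    rw [hx'] at hx
    exact hx.beamOptimal hp
  · filter_upwards [MisoSWIPT.ae_rank_eq_one hK hs] with h hh p hp x hx
    have h1 := hh p hp x hx
    -- Rank two almost surely never occurs, so the uniqueness clause for `K = 3` is vacuous.
    exact ⟨fun _ => h1, fun _ => ⟨fun i => .inl (h1 i), fun i j hi _ => by simp [h1 i] at hi⟩⟩
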